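/- Let $R$ be a field and $n\ge 0$. Let $Q_n$ be the quiver $1\to 2\to\cdots\to n$ and $RQ_n$ its path algebra, whose finite-dimensional left modules are identified with the finite-dimensional representations of $Q_n$ over $R$. For a finite-dimensional algebra $\Lambda$ and a finite-dimensional $\Lambda$-module $U$, let $\iota_U(M)$ be the greatest submodule of the finite-dimensional module $M$ that is a quotient of some $U^{d}$. The projection functor $p_U$ is the endofunctor $M\mapsto M/\iota_U(M)$ of the category of finite-dimensional $\Lambda$-modules, with the induced maps on morphisms. Let $\mathcal M(Q_n)$ be the monoid of natural isomorphism classes of endofunctors generated by the $p_S$ with $S$ a simple $RQ_n$-module, with composition as multiplication ($FG$ means first $G$, then $F$). Let $A_n=R\,\mathcal M(Q_n)$ be its monoid algebra, and let $p_i\in A_n$ be the class of $p_{S_i}$, where $S_i$ is the simple module at the vertex $i$. In what follows elements with upper index $m\le n$ are formed in $A_n$ from $p_1,\dots,p_m$. Put $y^m_0=1$ for $m\ge0$, $y^0_k=0$ for $k\ge1$, and for $m,k\ge 1$ $$y^m_k=y^{m-1}_k-p_m\,y^{m-1}_k+y^{m-1}_{k-1}\,p_m ,$$ so that $y^m_k=0$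 for $k>m$. Put $z^n_k=y^n_k-y^n_{k+1}$ for $0\le k\le n$. For $\emptyset\ne J\subseteq\{1,\dots,m\}$ put $$g^m_J=\begin{cases} g^{m-1}_J-p_m\,g^{m-1}_J & \text{if } m\notin J,\\ p_m & \text{if } J=\{m\},\\ g^{m-1}_{J\setminus\{m\}}\,p_m & \text{if } m\in J\ne\{m\}.\end{cases}$$ Put $f^n_\emptyset=z^n_0$ and $f^n_J=g^n_J\,z^n_{|J|}$ for $\emptyset\ne J\subseteq\{1,\dots,n\}$. For subsets $K=\{k_1<\dots<k_r\}$ and $J=\{j_1<\dots<j_s\}$ of $\{1,\dots,n\}$ write $K\ge J$ if $r=s$ and $k_i\ge j_i$ for all $i$. In that case let $$p_{(K,J)}=(p_{k_1}p_{k_1-1}\cdots p_{j_1})(p_{k_2}p_{k_2-1}\cdots p_{j_2})\cdots(p_{k_r}p_{k_r-1}\cdots p_{j_r})\in A_n,$$ with $p_{(\emptyset,\emptyset)}=1$. **Theorem.** For all subsets $K,J$ of $\{1,\dots,n\}$ with $K\ge J$ one has $$f^n_K\;p_{(K,J)}\;f^n_J\ne 0\quad\text{in } A_n .$$ -/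

import Mathlib

open CategoryTheory

universe u

noncomputable section

namespace ProjectionFunctors

/-! ### Projection functors on the category of finitely generated left modules -/

section Functors

variable {A : Type u} [Ring A]

/-- `M` lies in `gen U`: it is isomorphic to a quotient of some `U ^ d`, i.e. there is a surjective
linear map `U ^ d → M`. -/
def InGen (A : Type u) [Ring A] (U M : Type u) [AddCommGroup U] [Module A U] [AddCommGroup M]
    [Module A M] : Prop :=
  ∃ (d : ℕ) (f : (Fin d → U) →ₗ[A] M), Function.Surjective f

/-- The submodule `ι_U(M)`: the supremum of all submodules of `M` that lie in `gen U`. For finitely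
generated modules over a noetherian ring (in particular over a finite dimensional algebra) it is
the greatest submodule of `M` that lies in `gen U`, see `isGreatest_genPart`. -/
def genPart (A : Type u) [Ring A] (U M : Type u) [AddCommGroup U] [Module A U] [AddCommGroup M]
    [Module A M] : Submodule A M :=
  sSup {N : Submodule A M | InGen A U N}

theorem inGen_bot (U M : Type u) [AddCommGroup U] [Module A U] [AddCommGroup M] [Module A M] :
    InGen A U (⊥ : Submodule A M) :=
  ⟨0, 0, fun _ => ⟨0, Subsingleton.elim _ _⟩⟩

theorem inGen_sup {U M : Type u} [AddCommGroup U] [Module A U] [AddCommGroup M] [Module A M]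
    {N₁ N₂ : Submodule A M} (h₁ : InGen A U N₁) (h₂ : InGen A U N₂) :
    InGen A U (N₁ ⊔ N₂ : Submodule A M) := by
  obtain ⟨d, f, hf⟩ := h₁
  obtain ⟨e, g, hg⟩ := h₂
  let F : (Fin (d + e) → U) →ₗ[A] M :=
    N₁.subtype ∘ₗ f ∘ₗ LinearMap.funLeft A U (Fin.castAdd e) +
      N₂.subtype ∘ₗ g ∘ₗ LinearMap.funLeft A U (Fin.natAdd d)
  have hF : ∀ v, F v ∈ N₁ ⊔ N₂ := fun v =>
    Submodule.add_mem_sup (f _).2 (g _).2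
  refine ⟨d + e, F.codRestrict _ hF, ?_⟩
  rintro ⟨x, hx⟩
  obtain ⟨a, ha, b, hb, rfl⟩ := Submodule.mem_sup.1 hx
  obtain ⟨v, hv⟩ := hf ⟨a, ha⟩
  obtain ⟨w, hw⟩ := hg ⟨b, hb⟩
  refine ⟨Fin.append v w, Subtype.ext ?_⟩
  have h1 : (fun i => Fin.append v w (Fin.castAdd e i)) = v := by
    funext i; simp
  have h2 : (fun i => Fin.append v w (Fin.natAdd d i)) = w := by
    funext i; simp
  change (f (fun i => Fin.append v w (Fin.castAdd e i)) : M) +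
    (g (fun i => Fin.append v w (Fin.natAdd d i)) : M) = a + b
  rw [h1, h2, hv, hw]

theorem isGreatest_genPart (U M : Type u) [AddCommGroup U] [Module A U] [AddCommGroup M]
    [Module A M] [IsNoetherian A M] :
    IsGreatest {N : Submodule A M | InGen A U N} (genPart A U M) := by
  refine ⟨?_, fun N hN => le_sSup hN⟩
  obtain ⟨N, hN, hmax⟩ := set_has_maximal_iff_noetherian.2 (inferInstance : IsNoetherian A M)
    {N : Submodule A M | InGen A U N} ⟨⊥, inGen_bot U M⟩
  have : genPart A U M = N := by
    refine le_antisymm (sSup_le fun N' hN' => ?_) (le_sSup hN)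
    by_contra hle
    exact hmax (N' ⊔ N) (inGen_sup hN' hN)
      (lt_of_le_of_ne le_sup_right fun h => hle (h ▸ le_sup_left))
  rw [this]
  exact hN

theorem genPart_le_comap (U : Type u) {M N : Type u} [AddCommGroup U] [Module A U]
    [AddCommGroup M] [Module A M] [AddCommGroup N] [Module A N] (f : M →ₗ[A] N) :
    genPart A U M ≤ (genPart A U N).comap f := by
  refine sSup_le fun X hX => ?_
  rw [← Submodule.map_le_iff_le_comap]
  refine le_sSup ?_
  obtain ⟨d, g, hg⟩ := hX
  refine ⟨d, (f.submoduleMap X) ∘ₗ g, ?_⟩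
  exact (f.submoduleMap_surjective X).comp hg

/-- The projection functor `p_U`: it sends `M` to `M / ι_U(M)`, and a linear map to the induced map
of the quotients. -/
def projFunctor (U : FGModuleCat.{u} A) : FGModuleCat.{u} A ⥤ FGModuleCat.{u} A where
  obj M := FGModuleCat.of A (M ⧸ genPart A U M)
  map {M N} f :=
    FGModuleCat.ofHom ((genPart A U M).mapQ (genPart A U N) f.hom.hom (genPart_le_comap U _))
  map_id M := by
    apply FGModuleCat.hom_ext
    apply Submodule.linearMap_qext
    rfl
  map_comp f g := by
    apply FGModuleCat.hom_ext
    apply Submodule.linearMap_qext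
    rfl

end Functors

/-- Isomorphism classes of endofunctors of a category. -/
def EndoClass (C : Type*) [Category* C] : Type _ :=
  Quotient (isIsomorphicSetoid (C ⥤ C))

namespace EndoClass

variable {C : Type*} [Category* C]

/-- The natural isomorphism class of an endofunctor. -/
def mk (F : C ⥤ C) : EndoClass C := Quotient.mk (isIsomorphicSetoid (C ⥤ C)) F

/-- The product of the classes of `F` and `G` is the class of the composite `M ↦ F (G M)`. -/
instance : Monoid (EndoClass C) where
  mul := Quotient.map₂ (fun F G => G ⋙ F)
    (by rintro F F' ⟨α⟩ G G' ⟨β⟩; exact ⟨NatIso.hcomp β α⟩)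
  one := mk (𝟭 C)
  mul_assoc := by
    rintro ⟨F⟩ ⟨G⟩ ⟨H⟩
    rfl
  one_mul := by
    rintro ⟨F⟩
    rfl
  mul_one := by
    rintro ⟨F⟩
    rfl

end EndoClass

/-- The monoid generated by the natural isomorphism classes of the projection functors `p_S`
attached to the simple `A`-modules `S`. Here `A` is to be a finite dimensional algebra over a field,
so that the finitely generated modules are the finite dimensional ones. -/
def projMonoid (A : Type u) [Ring A] : Submonoid (EndoClass (FGModuleCat.{u} A)) :=
  Submonoid.closure
    {x | ∃ S : FGModuleCat.{u} A, IsSimpleModule A S ∧ x = EndoClass.mk (projFunctor S)}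

/-! ### Path algebras -/

/-- A path of the quiver `Q`, together with its source and target. -/
structure QPath (Q : Type) [Quiver.{0} Q] : Type where
  src : Q
  tgt : Q
  path : Quiver.Path src tgt

/-- The path of length zero at the vertex `t`. -/
def QPath.nil {Q : Type} [Quiver.{0} Q] (t : Q) : QPath Q := ⟨t, t, Quiver.Path.nil⟩

/-- The path algebra of a quiver: the free `k`-module on the paths. -/
def PathAlgebra (k : Type u) (Q : Type) [CommRing k] [Quiver.{0} Q] : Type u := QPath Q →₀ k

namespace PathAlgebra

variable {k : Type u} {Q : Type} [CommRing k] [Quiver.{0} Q]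

instance : AddCommGroup (PathAlgebra k Q) := inferInstanceAs (AddCommGroup (QPath Q →₀ k))

instance : Module k (PathAlgebra k Q) := inferInstanceAs (Module k (QPath Q →₀ k))

/-- The basis element given by a path. -/
def ofPath (p : QPath Q) : PathAlgebra k Q := Finsupp.single p 1

open Classical in
/-- The product of two paths: `p q` is the path "first `q`, then `p`" if `q` ends where `p` starts,
and zero otherwise. -/
def pathMul (p q : QPath Q) : PathAlgebra k Q :=
  if h : q.tgt = p.src then ofPath ⟨q.src, p.tgt, q.path.comp (p.path.cast h.symm rfl)⟩ else 0

/-- The multiplication of the path algebra, the bilinear extension of the product of paths. -/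
def mulMap : PathAlgebra k Q →ₗ[k] PathAlgebra k Q →ₗ[k] PathAlgebra k Q :=
  Finsupp.linearCombination k fun p : QPath Q =>
    (Finsupp.linearCombination k fun q : QPath Q => (pathMul p q : PathAlgebra k Q) :
      (QPath Q →₀ k) →ₗ[k] PathAlgebra k Q)

instance : Mul (PathAlgebra k Q) := ⟨fun a b => mulMap a b⟩

theorem mul_def (a b : PathAlgebra k Q) : a * b = mulMap a b := rfl

theorem ofPath_mul (p q : QPath Q) :
    (ofPath p * ofPath q : PathAlgebra k Q) = pathMul p q := by
  rw [mul_def]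
  unfold mulMap ofPath
  erw [Finsupp.linearCombination_single, one_smul, Finsupp.linearCombination_single, one_smul]

theorem ofPath_mul_of_eq {a b c : Q} (p : Quiver.Path b c) (q : Quiver.Path a b) :
    (ofPath ⟨b, c, p⟩ * ofPath ⟨a, b, q⟩ : PathAlgebra k Q) = ofPath ⟨a, c, q.comp p⟩ := by
  rw [ofPath_mul]
  simp [pathMul]

theorem ofPath_mul_of_ne {p q : QPath Q} (h : q.tgt ≠ p.src) :
    (ofPath p * ofPath q : PathAlgebra k Q) = 0 := by
  rw [ofPath_mul]
  simp [pathMul, h]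

theorem hom_ext {M : Type*} [AddCommGroup M] [Module k M] {f g : PathAlgebra k Q →ₗ[k] M}
    (h : ∀ p, f (ofPath p) = g (ofPath p)) : f = g :=
  Finsupp.lhom_ext' fun p => LinearMap.ext_ring (h p)

theorem mul_assoc_ofPath (p q r : QPath Q) :
    (ofPath p * ofPath q * ofPath r : PathAlgebra k Q) = ofPath p * (ofPath q * ofPath r) := by
  have zm : ∀ a : PathAlgebra k Q, 0 * a = 0 := fun a => by simp [mul_def]
  have mz : ∀ a : PathAlgebra k Q, a * 0 = 0 := fun a => by simp [mul_def]
  obtain ⟨p1, p2, p⟩ := p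
  obtain ⟨q1, q2, q⟩ := q
  obtain ⟨r1, r2, r⟩ := r
  by_cases h : q2 = p1
  · subst h
    by_cases h' : r2 = q1
    · subst h'
      simp only [ofPath_mul_of_eq, Quiver.Path.comp_assoc]
    · rw [ofPath_mul_of_eq, ofPath_mul_of_ne h', ofPath_mul_of_ne h', mz]
  · by_cases h' : r2 = q1
    · subst h'
      rw [ofPath_mul_of_eq, ofPath_mul_of_ne h, ofPath_mul_of_ne h, zm]
    · rw [ofPath_mul_of_ne h, ofPath_mul_of_ne h', zm, mz]

/-- The coefficient of a path in an element of the path algebra. -/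
def coeff (p : QPath Q) : PathAlgebra k Q →ₗ[k] k :=
  (Finsupp.lapply p : (QPath Q →₀ k) →ₗ[k] k)

open Classical in
theorem coeff_ofPath (p q : QPath Q) :
    coeff q (ofPath p : PathAlgebra k Q) = if p = q then 1 else 0 :=
  Finsupp.single_apply

variable [Fintype Q]

/-- The unit element is the sum of all paths of length zero. -/
instance : One (PathAlgebra k Q) := ⟨∑ t : Q, ofPath (QPath.nil t)⟩

theorem one_def : (1 : PathAlgebra k Q) = ∑ t : Q, ofPath (QPath.nil t) := rfl

instance : Ring (PathAlgebra k Q) where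
  __ := (inferInstance : AddCommGroup (PathAlgebra k Q))
  left_distrib a b c := by simp [mul_def]
  right_distrib a b c := by simp [mul_def]
  zero_mul a := by simp [mul_def]
  mul_zero a := by simp [mul_def]
  mul_assoc a b c := by
    have : (LinearMap.llcomp k _ _ _ mulMap ∘ₗ mulMap :
          PathAlgebra k Q →ₗ[k] PathAlgebra k Q →ₗ[k] PathAlgebra k Q →ₗ[k] PathAlgebra k Q) =
        ((LinearMap.llcomp k _ _ _).flip mulMap ∘ₗ LinearMap.llcomp k _ _ _ ∘ₗ mulMap) := by
      refine hom_ext fun p => hom_ext fun q => hom_ext fun r => ?_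
      exact mul_assoc_ofPath p q r
    exact congrArg (fun F => F a b c) this
  one_mul a := by
    have : (mulMap 1 : PathAlgebra k Q →ₗ[k] PathAlgebra k Q) = LinearMap.id := by
      refine hom_ext fun p => ?_
      rw [one_def, map_sum, LinearMap.sum_apply, Finset.sum_eq_single p.tgt]
      · exact ofPath_mul_of_eq Quiver.Path.nil p.path
      · intro t _ ht
        exact ofPath_mul_of_ne (p := QPath.nil t) (q := p) (Ne.symm ht)
      · simp
    exact congrArg (fun F => F a) this
  mul_one a := by
    have : (mulMap.flip 1 : PathAlgebra k Q →ₗ[k] PathAlgebra k Q) = LinearMap.id := by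
      refine hom_ext fun p => ?_
      rw [one_def, map_sum, LinearMap.sum_apply, Finset.sum_eq_single p.src]
      · exact (ofPath_mul_of_eq p.path Quiver.Path.nil).trans (by simp [Quiver.Path.nil_comp])
      · intro t _ ht
        exact ofPath_mul_of_ne (p := p) (q := QPath.nil t) ht
      · simp
    exact congrArg (fun F => F a) this

instance : Algebra k (PathAlgebra k Q) :=
  Algebra.ofModule (fun r a b => by simp [mul_def]) (fun r a b => by simp [mul_def])

/-- The ring homomorphism to `k` that sends the path of length zero at `t` to one and every other
path to zero. -/
def vertexHom (k : Type u) [CommRing k] (t : Q) : PathAlgebra k Q →+* k where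
  toFun a := coeff (QPath.nil t) a
  map_zero' := map_zero _
  map_add' := map_add _
  map_one' := by
    classical
    rw [one_def, map_sum, Finset.sum_eq_single t]
    · rw [coeff_ofPath, if_pos rfl]
    · intro s _ hs
      rw [coeff_ofPath, if_neg fun h => hs (congrArg QPath.src h)]
    · simp
  map_mul' a b := by
    classical
    have : mulMap.compr₂ (coeff (k := k) (QPath.nil t)) =
        (LinearMap.mul k k).compl₁₂ (coeff (QPath.nil t)) (coeff (QPath.nil t)) := by
      refine hom_ext fun p => hom_ext fun q => ?_
      change coeff (k := k) (QPath.nil t) (ofPath p * ofPath q) =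
        coeff (QPath.nil t) (ofPath p) * coeff (QPath.nil t) (ofPath q)
      obtain ⟨p1, p2, p⟩ := p
      obtain ⟨q1, q2, q⟩ := q
      by_cases h : q2 = p1
      · subst h
        rw [ofPath_mul_of_eq, coeff_ofPath, coeff_ofPath, coeff_ofPath]
        cases p with
        | nil =>
          rw [Quiver.Path.comp_nil]
          by_cases h2 : p2 = t
          · subst h2
            have : (⟨p2, p2, Quiver.Path.nil⟩ : QPath Q) = QPath.nil p2 := rfl
            rw [if_pos this, one_mul]
          · have h3 : (⟨p2, p2, Quiver.Path.nil⟩ : QPath Q) ≠ QPath.nil t :=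
              fun h => h2 (congrArg QPath.src h)
            have h4 : (⟨q1, p2, q⟩ : QPath Q) ≠ QPath.nil t :=
              fun h => h2 (congrArg QPath.tgt h)
            rw [if_neg h3, if_neg h4, zero_mul]
        | cons p e =>
          have key : ∀ {a b c : Q} (r : Quiver.Path a b) (e : b ⟶ c),
              (⟨a, c, r.cons e⟩ : QPath Q) ≠ QPath.nil t := by
            intro a b c r e h
            have := congrArg (fun x : QPath Q => x.path.length) h
            simp [QPath.nil] at this
          rw [Quiver.Path.comp_cons, if_neg (key _ _), if_neg (key _ _), zero_mul]
      · rw [ofPath_mul_of_ne h, map_zero, coeff_ofPath, coeff_ofPath]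
        by_cases h1 : (⟨p1, p2, p⟩ : QPath Q) = QPath.nil t
        · have h2 : (⟨q1, q2, q⟩ : QPath Q) ≠ QPath.nil t := fun h2 =>
            h ((congrArg QPath.tgt h2).trans (congrArg QPath.src h1).symm)
          rw [if_neg h2, mul_zero]
        · rw [if_neg h1, zero_mul]
    exact congrArg (fun F => F a b) this

theorem vertexHom_apply (t : Q) (a : PathAlgebra k Q) :
    vertexHom k t a = coeff (QPath.nil t) a := rfl

end PathAlgebra

/-- The simple module attached to the vertex `t`: it is `k` as a vector space, the path of length
zero at `t` acts as the identity and every other path acts as zero. -/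
def VertexModule (k : Type u) {Q : Type} [Field k] [Quiver.{0} Q] (_t : Q) : Type u := k

namespace VertexModule

variable (k : Type u) {Q : Type} [Field k] [Quiver.{0} Q] [Fintype Q] (t : Q)

instance : AddCommGroup (VertexModule k t) := inferInstanceAs (AddCommGroup k)

instance : Module (PathAlgebra k Q) (VertexModule k t) :=
  Module.compHom k (PathAlgebra.vertexHom k t)

theorem smul_def (a : PathAlgebra k Q) (x : k) :
    (a • (show VertexModule k t from x) : VertexModule k t) = PathAlgebra.vertexHom k t a * x := rfl

theorem exists_smul (x y : k) (hx : x ≠ 0) :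
    ∃ a : PathAlgebra k Q, (a • (show VertexModule k t from x) : VertexModule k t) = y := by
  classical
  refine ⟨(y * x⁻¹) • PathAlgebra.ofPath (QPath.nil t), ?_⟩
  rw [smul_def, PathAlgebra.vertexHom_apply, map_smul, PathAlgebra.coeff_ofPath, if_pos rfl,
    smul_eq_mul, mul_one, inv_mul_cancel_right₀ hx]

instance : Nontrivial (VertexModule k t) := inferInstanceAs (Nontrivial k)

instance : IsSimpleModule (PathAlgebra k Q) (VertexModule k t) := by
  rw [isSimpleModule_iff_toSpanSingleton_surjective]
  exact ⟨inferInstance, fun x hx y => exists_smul k t x y hx⟩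

instance : Module.Finite (PathAlgebra k Q) (VertexModule k t) := inferInstance

end VertexModule

/-! ### The linearly oriented quiver `1 → 2 → ⋯ → n` -/

/-- The vertex set `{1, …, n}` of the quiver `Q_n`. -/
def LinQuiver (n : ℕ) : Type := {i : ℕ // i ∈ Finset.Icc 1 n}

instance (n : ℕ) : Fintype (LinQuiver n) :=
  inferInstanceAs (Fintype {i : ℕ // i ∈ Finset.Icc 1 n})

/-- There is exactly one arrow `i → i + 1` for `1 ≤ i < n`, and there are no other arrows. -/
instance (n : ℕ) : Quiver.{0} (LinQuiver n) where
  Hom i j := PLift (j.1 = i.1 + 1)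

theorem LinQuiver.path_length {n : ℕ} {i j : LinQuiver n} (p : Quiver.Path i j) :
    j.1 = i.1 + p.length := by
  induction p with
  | nil => rfl
  | cons p e ih => rw [Quiver.Path.length_cons, e.down, ih]; omega

theorem LinQuiver.path_subsingleton {n : ℕ} {i j : LinQuiver n} (p q : Quiver.Path i j) :
    p = q := by
  induction p with
  | nil =>
    have h := LinQuiver.path_length q
    exact (Quiver.Path.eq_nil_of_length_zero q (by omega)).symm
  | @cons b c p e ih =>
    cases q with
    | nil =>
      have h := LinQuiver.path_length p
      have h' := e.down
      omega
    | @cons b' _ q e' =>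
      have hb : b = b' := Subtype.ext (by have h1 := e.down; have h2 := e'.down; omega)
      subst hb
      have he : e = e' := PLift.down_injective rfl
      rw [ih q, he]

/-- The path algebra of `Q_n` is finite dimensional. -/
instance (k : Type u) [Field k] (n : ℕ) : Module.Finite k (PathAlgebra k (LinQuiver n)) := by
  have : Finite (QPath (LinQuiver n)) := by
    refine Finite.of_injective (fun p : QPath (LinQuiver n) => (p.src, p.tgt)) ?_
    rintro ⟨a, b, p⟩ ⟨c, d, q⟩ h
    obtain ⟨rfl, rfl⟩ := Prod.mk.inj h
    rw [LinQuiver.path_subsingleton p q]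
  exact inferInstanceAs (Module.Finite k (QPath (LinQuiver n) →₀ k))

/-- The algebra `A_n`: the monoid algebra over `R` of the monoid of projection functors of the path
algebra `R Q_n`. -/
abbrev AlgA (R : Type u) [Field R] (n : ℕ) : Type (u + 1) :=
  MonoidAlgebra R (projMonoid (PathAlgebra R (LinQuiver n)))

/-- The element `p_t` of the monoid, the class of the projection functor attached to `S_t`. -/
def projClass (R : Type u) [Field R] {n : ℕ} (t : LinQuiver n) :
    projMonoid (PathAlgebra R (LinQuiver n)) :=
  ⟨EndoClass.mk (projFunctor (FGModuleCat.of (PathAlgebra R (LinQuiver n)) (VertexModule R t))),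
    Submonoid.subset_closure ⟨FGModuleCat.of _ (VertexModule R t),
      inferInstanceAs (IsSimpleModule (PathAlgebra R (LinQuiver n)) (VertexModule R t)), rfl⟩⟩

/-- The generator `p_i` of `A_n` for `1 ≤ i ≤ n` (with the unused value `1` for other `i`). -/
def gen (R : Type u) [Field R] (n i : ℕ) : AlgA R n :=
  if h : i ∈ Finset.Icc 1 n then
    MonoidAlgebra.of R _ (projClass R (⟨i, h⟩ : LinQuiver n))
  else 1

/-! ### The elements of `A_n`

The elements with upper index `m ≤ n` are polynomials in `p_1, …, p_m`. They are written for an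
arbitrary sequence `p` in a ring, and so can be formed in `A_n` for every `n ≥ m`; this is the
inclusion of `A_m` in `A_n`. -/

section Elements

variable {B : Type*} [Ring B]

/-- The elements `y_k^m`, with the convention `y_0^m = 1`:
`y_k^m = y_k^(m-1) - p_m y_k^(m-1) + y_(k-1)^(m-1) p_m`, and `y_k^m = 0` for `k > m`. -/
def yElt (p : ℕ → B) : ℕ → ℕ → B
  | _, 0 => 1
  | 0, _ + 1 => 0
  | m + 1, k + 1 => yElt p m (k + 1) - p (m + 1) * yElt p m (k + 1) + yElt p m k * p (m + 1)

/-- The elements `z_k^m = y_k^m - y_(k+1)^m`, in particular `z_0^m = 1 - y_1^m`. -/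
def zElt (p : ℕ → B) (m k : ℕ) : B := yElt p m k - yElt p m (k + 1)

/-- The elements `g_J^m` for non-empty subsets `J` of `{1, …, m}` (for other `J` the value is not
used). -/
def gElt (p : ℕ → B) : ℕ → Finset ℕ → B
  | 0, _ => 0
  | m + 1, J =>
    if m + 1 ∉ J then gElt p m J - p (m + 1) * gElt p m J
    else if J = {m + 1} then p (m + 1)
    else gElt p m (J.erase (m + 1)) * p (m + 1)

/-- The elements `f_J^m` for subsets `J` of `{1, …, m}`. -/
def fElt (p : ℕ → B) (m : ℕ) (J : Finset ℕ) : B :=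
  if J = ∅ then zElt p m 0 else gElt p m J * zElt p m J.card

/-- The monomial `p_k p_(k-1) ⋯ p_(j+1) p_j` of the word `k ↘ j`, for `k ≥ j`. -/
def descMonomial (p : ℕ → B) (k j : ℕ) : B :=
  ((List.range' j (k + 1 - j)).reverse.map p).prod

/-- The monomial `p_(K,J)`, the product of the monomials of the words `k_1 ↘ j_1`, …, `k_r ↘ j_r` in
this order, where `k_1 < ⋯ < k_r` and `j_1 < ⋯ < j_r` are the elements of `K` and of `J`. -/
def pairMonomial (p : ℕ → B) (K J : Finset ℕ) : B :=
  (List.zipWith (descMonomial p) K.sort J.sort).prod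

end Elements

/-- The product order `K ≥ J` on finite sets of natural numbers: the sets have the same number of
elements, and if `k_1 < ⋯ < k_r` and `j_1 < ⋯ < j_r` are the elements of `K` and of `J`, then
`k_i ≥ j_i` for all `i`. -/
def ProdGE (K J : Finset ℕ) : Prop :=
  List.Forall₂ (fun k j => k ≥ j) K.sort J.sort

end ProjectionFunctors

end

noncomputable section

namespace ProjectionFunctors

/-! ### Operators that shift finite sets of natural numbers -/

section Shift

open Finset

/-! Nonvanishing is detected in a representation of A_n. For 0 ≤ b ≤ n let M_b be the uniserial
module with composition factors at 1, …, b from the top down, so M_0 = 0. The socle of M_b is the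
simple at b when b ≥ 1, so up to isomorphism p_t sends M_t to M_(t-1) and fixes every other M_b
(`projFunctor_uniserial`). The monoid thus acts on isomorphism classes, and then linearly on finite
sets of classes: a set goes to its image if the map is injective on it, and to zero otherwise
(`imageMap_comp`). Let e_J be the vector of the set of all M_b with b ∉ J. In terms of the holes J,
p_i fixes e_J if i ∈ J, moves a hole from i - 1 to i if i - 1 ∈ J and i ∉ J, and gives zero
otherwise (`isShiftAction_complVec`).

The rest uses only these rules. Here z_|J| fixes e_J and g_J is unitriangular on it, so f_J e_J is
e_J plus a combination of e_L with L above J (`fElt_apply_sub_mem`). The monomial p_(K,J) carries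
e_J to e_K (`pairMonomial_apply`) and kills e_L for every L above J
(`pairMonomial_apply_of_mem_above`). Hence the product sends e_J to e_K plus terms above K, which is
not zero.

"Above" is measured by the counting functions x ↦ |J ∩ [0, x]|: the one of L is at most that of J,
and L ≠ J. This also admits L with fewer elements than J. -/

/-- The number of elements of `J` that are at most `x`. -/
def countLE (J : Finset ℕ) (x : ℕ) : ℕ := (J.filter (· ≤ x)).card

theorem countLE_mono (J : Finset ℕ) {x y : ℕ} (h : x ≤ y) : countLE J x ≤ countLE J y :=
  card_le_card fun a ha => by simp only [mem_filter] at ha ⊢; exact ⟨ha.1, ha.2.trans h⟩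

theorem filter_le_succ_of_mem {J : Finset ℕ} {m : ℕ} (h : m + 1 ∈ J) :
    J.filter (· ≤ m + 1) = insert (m + 1) (J.filter (· ≤ m)) := by
  ext a
  simp only [mem_filter, mem_insert]
  constructor
  · rintro ⟨h1, h2⟩
    by_cases h3 : a = m + 1
    · exact Or.inl h3
    · exact Or.inr ⟨h1, by omega⟩
  · rintro (rfl | ⟨h1, h2⟩)
    · exact ⟨h, le_rfl⟩
    · exact ⟨h1, by omega⟩

theorem filter_le_succ_of_notMem {J : Finset ℕ} {m : ℕ} (h : m + 1 ∉ J) :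
    J.filter (· ≤ m + 1) = J.filter (· ≤ m) := by
  ext a
  simp only [mem_filter]
  refine and_congr_right fun ha => ⟨fun h1 => ?_, fun h1 => by omega⟩
  have : a ≠ m + 1 := fun h2 => h (h2 ▸ ha)
  omega

theorem countLE_succ_of_mem {J : Finset ℕ} {m : ℕ} (h : m + 1 ∈ J) :
    countLE J (m + 1) = countLE J m + 1 := by
  rw [countLE, filter_le_succ_of_mem h, card_insert_of_notMem (by simp), countLE]

theorem countLE_succ_of_notMem {J : Finset ℕ} {m : ℕ} (h : m + 1 ∉ J) :
    countLE J (m + 1) = countLE J m := by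
  rw [countLE, filter_le_succ_of_notMem h, countLE]

/-- A jump of the counting function between m and m + 1 detects m + 1. This gives antisymmetry of
the comparison by counting functions. -/
theorem eq_of_countLE_eq {J L : Finset ℕ} (hJ : 0 ∉ J) (hL : 0 ∉ L)
    (h : ∀ x, countLE J x = countLE L x) : J = L := by
  ext a
  cases a with
  | zero => simp [hJ, hL]
  | succ m =>
    have h1 := h m
    have h2 := h (m + 1)
    by_cases ha : m + 1 ∈ J <;> by_cases hb : m + 1 ∈ L
    · simp [ha, hb]
    · rw [countLE_succ_of_mem ha, countLE_succ_of_notMem hb] at h2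
      omega
    · rw [countLE_succ_of_notMem ha, countLE_succ_of_mem hb] at h2
      omega
    · simp [ha, hb]

/-- The set `J` with its element `m` replaced by `m + 1`. -/
def shiftUp (m : ℕ) (J : Finset ℕ) : Finset ℕ := insert (m + 1) (J.erase m)

theorem shiftUp_subset {n m : ℕ} {J : Finset ℕ} (hm : m + 1 ≤ n) (hJ : J ⊆ Icc 1 n) :
    shiftUp m J ⊆ Icc 1 n := by
  intro a ha
  rcases mem_insert.1 ha with rfl | h
  · simp [hm]
  · exact hJ (mem_of_mem_erase h)

theorem countLE_shiftUp_self {m : ℕ} {J : Finset ℕ} (hm : m ∈ J) :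
    countLE (shiftUp m J) m + 1 = countLE J m := by
  have : (shiftUp m J).filter (· ≤ m) = (J.filter (· ≤ m)).erase m := by
    ext a
    simp only [shiftUp, mem_filter, mem_insert, mem_erase]
    constructor
    · rintro ⟨rfl | ⟨h1, h2⟩, h3⟩
      · omega
      · exact ⟨h1, h2, h3⟩
    · rintro ⟨h1, h2, h3⟩
      exact ⟨Or.inr ⟨h1, h2⟩, h3⟩
  rw [countLE, this, card_erase_add_one (by simp [hm]), countLE]

/-- Moving an element to the right never raises the counting function, so the operators only move
basis vectors upwards. If m + 1 was already in J, an element is lost, which also fits. -/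
theorem countLE_shiftUp_le {m : ℕ} {J : Finset ℕ} (hm : m ∈ J) (x : ℕ) :
    countLE (shiftUp m J) x ≤ countLE J x := by
  by_cases hx : x ≤ m
  · refine card_le_card fun a ha => ?_
    simp only [shiftUp, mem_filter, mem_insert, mem_erase] at ha ⊢
    rcases ha with ⟨rfl | ⟨h1, h2⟩, h3⟩
    · omega
    · exact ⟨h2, h3⟩
  · have h1 : (shiftUp m J).filter (· ≤ x) ⊆ insert (m + 1) ((J.filter (· ≤ x)).erase m) := by
      intro a ha
      simp only [shiftUp, mem_filter, mem_insert, mem_erase] at ha ⊢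
      tauto
    refine (card_le_card h1).trans ((card_insert_le _ _).trans ?_)
    rw [card_erase_add_one (by simp only [mem_filter]; exact ⟨hm, by omega⟩), countLE]

theorem descMonomial_self {B : Type*} [Ring B] (p : ℕ → B) (j : ℕ) :
    descMonomial p j j = p j := by
  simp [descMonomial]

theorem descMonomial_succ {B : Type*} [Ring B] (p : ℕ → B) {k j : ℕ}
    (hjk : j ≤ k) : descMonomial p (k + 1) j = p (k + 1) * descMonomial p k j := by
  have h1 : k + 1 + 1 - j = (k + 1 - j) + 1 := by omega
  have h2 : j + (k + 1 - j) = k + 1 := by omega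
  rw [descMonomial, h1, List.range'_concat, descMonomial]
  simp [h2]

/-! ### Shift actions: diagonal and unitriangular elements -/

variable {R V : Type*} [CommRing R] [AddCommGroup V] [Module R V]

/-- The operators `P 1, …, P n` act on the vectors `e J`, for `J ⊆ {1, …, n}`, by
`P i (e J) = e J` if `i ∈ J`, by replacing `i - 1 ∈ J` by `i` if `i ∉ J`, and as zero if `J` contains
neither `i` nor `i - 1`. -/
structure IsShiftAction (n : ℕ) (P : ℕ → Module.End R V) (e : Finset ℕ → V) : Prop where
  of_mem : ∀ {m : ℕ} {J : Finset ℕ}, m + 1 ≤ n → J ⊆ Icc 1 n → m + 1 ∈ J → P (m + 1) (e J) = e J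
  of_pred_mem : ∀ {m : ℕ} {J : Finset ℕ}, m + 1 ≤ n → J ⊆ Icc 1 n → m + 1 ∉ J → m ∈ J →
    P (m + 1) (e J) = e (shiftUp m J)
  of_notMem : ∀ {m : ℕ} {J : Finset ℕ}, m + 1 ≤ n → J ⊆ Icc 1 n → m + 1 ∉ J → m ∉ J →
    P (m + 1) (e J) = 0

namespace IsShiftAction

variable {n : ℕ} {P : ℕ → Module.End R V} {e : Finset ℕ → V}

/-- In the recursion, if m + 1 ∈ J the first two terms cancel and the third lowers k by one. If only
m ∈ J, the shifted set has one element fewer up to m, so the last two terms appear under the same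
condition and cancel. If neither is in J, they both vanish. -/
theorem yElt_apply (h : IsShiftAction n P e) {m : ℕ} (hm : m ≤ n) (k : ℕ) {J : Finset ℕ}
    (hJ : J ⊆ Icc 1 n) : yElt P m k (e J) = if k ≤ countLE J m then e J else 0 := by
  induction m generalizing k J with
  | zero =>
    cases k with
    | zero => simp [yElt]
    | succ k =>
      have : countLE J 0 = 0 := by
        rw [countLE, card_eq_zero, filter_eq_empty_iff]
        intro a ha
        have := mem_Icc.1 (hJ ha)
        omega
      simp [yElt, this]
  | succ m ih =>
    cases k with
    | zero => simp [yElt]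
    | succ k =>
      have hm' : m ≤ n := by omega
      simp only [yElt, LinearMap.add_apply, LinearMap.sub_apply, Module.End.mul_apply]
      rw [ih hm' (k + 1) hJ]
      by_cases h1 : m + 1 ∈ J
      · rw [h.of_mem hm hJ h1, ih hm' k hJ, countLE_succ_of_mem h1]
        by_cases h2 : k + 1 ≤ countLE J m
        · rw [if_pos h2, h.of_mem hm hJ h1, if_pos (by omega), if_pos (by omega)]
          simp
        · rw [if_neg h2]
          simp
      · rw [countLE_succ_of_notMem h1]
        by_cases h3 : m ∈ J
        · have h4 := countLE_shiftUp_self h3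
          rw [h.of_pred_mem hm hJ h1 h3, ih hm' k (shiftUp_subset hm hJ)]
          by_cases h2 : k + 1 ≤ countLE J m
          · rw [if_pos h2, h.of_pred_mem hm hJ h1 h3, if_pos (by omega)]
            simp
          · rw [if_neg h2, if_neg (by omega)]
            simp
        · rw [h.of_notMem hm hJ h1 h3]
          by_cases h2 : k + 1 ≤ countLE J m
          · rw [if_pos h2, h.of_notMem hm hJ h1 h3]
            simp
          · rw [if_neg h2]
            simp

theorem zElt_card_apply (h : IsShiftAction n P e) {J : Finset ℕ} (hJ : J ⊆ Icc 1 n) :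
    zElt P n J.card (e J) = e J := by
  have : countLE J n = J.card := by
    rw [countLE, filter_true_of_mem fun a ha => (mem_Icc.1 (hJ ha)).2]
  rw [zElt, LinearMap.sub_apply, h.yElt_apply le_rfl _ hJ, h.yElt_apply le_rfl _ hJ, this]
  simp

/-- The span of the vectors `e L` with `L > J` in the product order. -/
def above (R : Type*) [CommRing R] [Module R V] (n : ℕ) (e : Finset ℕ → V) (J : Finset ℕ) :
    Submodule R V :=
  Submodule.span R (e '' {L | L ⊆ Icc 1 n ∧ (∀ x, countLE L x ≤ countLE J x) ∧ L ≠ J})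

/-- A nonzero result is indexed by a set that contains m + 1, hence differs from J. The case L = J
is included, so `1 - P (m + 1)` changes e_J only by terms above J. -/
theorem apply_mem_above (h : IsShiftAction n P e) {m : ℕ} (hm : m + 1 ≤ n) {J L : Finset ℕ}
    (hJ : m + 1 ∉ J) (hL : L ⊆ Icc 1 n) (hLJ : ∀ x, countLE L x ≤ countLE J x) :
    P (m + 1) (e L) ∈ above R n e J := by
  by_cases h1 : m + 1 ∈ L
  · rw [h.of_mem hm hL h1]
    exact Submodule.subset_span ⟨L, ⟨hL, hLJ, fun h2 => hJ (h2 ▸ h1)⟩, rfl⟩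
  · by_cases h2 : m ∈ L
    · rw [h.of_pred_mem hm hL h1 h2]
      refine Submodule.subset_span ⟨_, ⟨shiftUp_subset hm hL,
        fun x => (countLE_shiftUp_le h2 x).trans (hLJ x), fun h3 => hJ ?_⟩, rfl⟩
      rw [← h3]
      exact mem_insert_self _ _
    · rw [h.of_notMem hm hL h1 h2]
      exact zero_mem _

theorem apply_mem_above_of_mem (h : IsShiftAction n P e) {m : ℕ} (hm : m + 1 ≤ n) {J : Finset ℕ}
    (hJ : m + 1 ∉ J) {v : V} (hv : v ∈ above R n e J) : P (m + 1) v ∈ above R n e J := by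
  have : above R n e J ≤ (above R n e J).comap (P (m + 1)) := by
    refine Submodule.span_le.2 ?_
    rintro _ ⟨L, ⟨hL, hLJ, -⟩, rfl⟩
    exact h.apply_mem_above hm hJ hL hLJ
  exact this hv

/-- The factors p_i with i ∈ J stand on the right and fix e_J; the factors 1 - p_i with i ∉ J, on
the left, preserve e_J modulo the span above J. The truncation of J must be nonempty, because the
recursion gives 0 on the empty set. -/
theorem gElt_apply_sub_mem (h : IsShiftAction n P e) {m : ℕ} (hm : m ≤ n) {J : Finset ℕ}
    (hJ : J ⊆ Icc 1 n) (hne : (J.filter (· ≤ m)).Nonempty) :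
    gElt P m (J.filter (· ≤ m)) (e J) - e J ∈ above R n e J := by
  induction m with
  | zero =>
    obtain ⟨a, ha⟩ := hne
    rw [mem_filter] at ha
    have := mem_Icc.1 (hJ ha.1)
    omega
  | succ m ih =>
    by_cases h1 : m + 1 ∈ J
    · have h0 : m + 1 ∉ J.filter (· ≤ m) := by simp
      rw [filter_le_succ_of_mem h1, gElt, if_neg (by simp)]
      by_cases h2 : J.filter (· ≤ m) = ∅
      · rw [h2, if_pos (by simp), h.of_mem hm hJ h1, sub_self]
        exact zero_mem _
      · have h3 : insert (m + 1) (J.filter (· ≤ m)) ≠ {m + 1} := by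
          intro h3
          apply h2
          rw [← erase_insert h0, h3]
          simp
        rw [if_neg h3, erase_insert h0, Module.End.mul_apply, h.of_mem hm hJ h1]
        exact ih (by omega) (nonempty_iff_ne_empty.2 h2)
    · rw [filter_le_succ_of_notMem h1] at hne ⊢
      have ih := ih (by omega) hne
      rw [gElt, if_pos (by simp), LinearMap.sub_apply, Module.End.mul_apply]
      set v := gElt P m (J.filter (· ≤ m)) (e J)
      have h2 : P (m + 1) v ∈ above R n e J := by
        have := add_mem (h.apply_mem_above_of_mem hm h1 ih)
          (h.apply_mem_above hm h1 hJ fun x => le_rfl)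
        rwa [← map_add, sub_add_cancel] at this
      have := sub_mem ih h2
      rwa [sub_right_comm] at this

theorem fElt_apply_sub_mem (h : IsShiftAction n P e) {J : Finset ℕ} (hJ : J ⊆ Icc 1 n) :
    fElt P n J (e J) - e J ∈ above R n e J := by
  have hz := h.zElt_card_apply hJ
  rw [fElt]
  split_ifs with h1
  · subst h1
    rw [card_empty] at hz
    rw [hz, sub_self]
    exact zero_mem _
  · have h2 : J.filter (· ≤ n) = J := filter_true_of_mem fun a ha => (mem_Icc.1 (hJ ha)).2
    have := h.gElt_apply_sub_mem le_rfl hJ (by rw [h2]; exact nonempty_iff_ne_empty.2 h1)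
    rw [h2] at this
    rwa [Module.End.mul_apply, hz]

/-! ### The monomials p_(K,J) on basis vectors -/

theorem descMonomial_apply_insert (h : IsShiftAction n P e) {j k : ℕ} (hj : 1 ≤ j) (hjk : j ≤ k)
    (hk : k ≤ n) {Y : Finset ℕ} (hY : Y ⊆ Icc 1 n) (hYjk : ∀ y ∈ Y, y < j ∨ k < y) :
    descMonomial P k j (e (insert j Y)) = e (insert k Y) := by
  induction k, hjk using Nat.le_induction with
  | base =>
    obtain ⟨m, rfl⟩ : ∃ m, j = m + 1 := ⟨j - 1, by omega⟩
    rw [descMonomial_self, h.of_mem hk _ (mem_insert_self _ _)]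
    exact insert_subset (by simp [hk]) hY
  | succ k hjk ih =>
    have h1 : k ∉ Y := fun hy => by have := hYjk k hy; omega
    have h2 : k + 1 ∉ Y := fun hy => by have := hYjk _ hy; omega
    rw [descMonomial_succ P hjk, Module.End.mul_apply,
      ih (by omega) fun y hy => by have := hYjk y hy; omega,
      h.of_pred_mem hk (insert_subset (mem_Icc.2 ⟨by omega, by omega⟩) hY) (by simp [h2])
        (mem_insert_self _ _), shiftUp, erase_insert h1]

/-- The rightmost word acts first, so the largest element moves first and each later one finds its
interval from j to k free. In the induction, Y holds the smaller elements that have yet to move. -/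
theorem prod_descMonomial_apply (h : IsShiftAction n P e) {ks js : List ℕ}
    (hkj : List.Forall₂ (fun k j => k ≥ j) ks js) (hks : ks.Pairwise (· < ·))
    (hjs : js.Pairwise (· < ·)) (hkn : ∀ k ∈ ks, k ≤ n) (hj1 : ∀ j ∈ js, 1 ≤ j) {Y : Finset ℕ}
    (hY : Y ⊆ Icc 1 n) (hYj : ∀ y ∈ Y, ∀ j ∈ js, y < j) :
    (List.zipWith (descMonomial P) ks js).prod (e (js.toFinset ∪ Y)) = e (ks.toFinset ∪ Y) := by
  induction hkj generalizing Y with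
  | nil => simp
  | @cons k j ks js hkj hkjs ih =>
    rw [List.pairwise_cons] at hks hjs
    have hj := hj1 j (by simp)
    have hk := hkn k (by simp)
    have h1 : (j :: js).toFinset ∪ Y = js.toFinset ∪ insert j Y := by
      ext; simp
    have h2 : (k :: ks).toFinset ∪ Y = insert k (ks.toFinset ∪ Y) := by
      ext; simp
    have h3 : ks.toFinset ∪ insert j Y = insert j (ks.toFinset ∪ Y) := by
      simp
    rw [List.zipWith_cons_cons, List.prod_cons, Module.End.mul_apply, h1,
      ih hks.2 hjs.2 (fun a ha => hkn a (by simp [ha])) (fun a ha => hj1 a (by simp [ha]))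
        (insert_subset (mem_Icc.2 ⟨hj, by omega⟩) hY), h3, h2]
    · refine h.descMonomial_apply_insert hj hkj hk (union_subset (fun a ha => ?_) hY) ?_
      · rw [List.mem_toFinset] at ha
        have := hks.1 a ha
        exact mem_Icc.2 ⟨by omega, hkn a (by simp [ha])⟩
      · intro y hy
        rcases mem_union.1 hy with hy | hy
        · exact Or.inr (hks.1 y (by simpa using hy))
        · exact Or.inl (hYj y hy j (by simp))
    · intro y hy a ha
      rcases mem_insert.1 hy with rfl | hy
      · exact hjs.1 a ha
      · exact hYj y hy a (by simp [ha])

theorem pairMonomial_apply (h : IsShiftAction n P e) {K J : Finset ℕ} (hK : K ⊆ Icc 1 n)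
    (hJ : J ⊆ Icc 1 n) (hKJ : ProdGE K J) : pairMonomial P K J (e J) = e K := by
  have := h.prod_descMonomial_apply hKJ (K.sortedLT_sort).pairwise (J.sortedLT_sort).pairwise
    (fun k hk => (mem_Icc.1 (hK ((mem_sort _).1 hk))).2)
    (fun j hj => (mem_Icc.1 (hJ ((mem_sort _).1 hj))).1) (empty_subset _) (by simp)
  simpa [pairMonomial] using this

theorem apply_eq_zero_or (h : IsShiftAction n P e) {m : ℕ} (hm : m + 1 ≤ n) {L : Finset ℕ}
    (hL : L ⊆ Icc 1 n) : P (m + 1) (e L) = 0 ∨ ∃ L' ⊆ Icc 1 n, P (m + 1) (e L) = e L' ∧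
      (∀ x, countLE L' x ≤ countLE L x) ∧ m + 1 ∈ L' := by
  by_cases h1 : m + 1 ∈ L
  · exact Or.inr ⟨L, hL, h.of_mem hm hL h1, fun x => le_rfl, h1⟩
  · by_cases h2 : m ∈ L
    · exact Or.inr ⟨_, shiftUp_subset hm hL, h.of_pred_mem hm hL h1 h2, countLE_shiftUp_le h2,
        mem_insert_self _ _⟩
    · exact Or.inl (h.of_notMem hm hL h1 h2)

/-- The factor p_j acts first and leaves a set containing j, so fewer elements lie strictly below j
than L had up to j. The later factors only lower the counts. -/
theorem descMonomial_apply_eq_zero_or (h : IsShiftAction n P e) {j k : ℕ} (hj : 1 ≤ j)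
    (hjk : j ≤ k) (hk : k ≤ n) {L : Finset ℕ} (hL : L ⊆ Icc 1 n) :
    descMonomial P k j (e L) = 0 ∨ ∃ L' ⊆ Icc 1 n, descMonomial P k j (e L) = e L' ∧
      (∀ x, countLE L' x ≤ countLE L x) ∧ ∀ b < j, countLE L' b + 1 ≤ countLE L j := by
  induction k, hjk using Nat.le_induction with
  | base =>
    obtain ⟨m, rfl⟩ : ∃ m, j = m + 1 := ⟨j - 1, by omega⟩
    rw [descMonomial_self]
    refine (h.apply_eq_zero_or hk hL).imp_right ?_
    rintro ⟨L', hL', h1, h2, h3⟩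
    refine ⟨L', hL', h1, h2, fun b hb => ?_⟩
    have h4 := countLE_mono L' (show b ≤ m by omega)
    have h5 := countLE_succ_of_mem h3
    have h6 := h2 (m + 1)
    omega
  | succ k hjk ih =>
    rw [descMonomial_succ P hjk, Module.End.mul_apply]
    rcases ih (by omega) with h0 | ⟨L₁, hL₁, h1, h2, h3⟩
    · left
      rw [h0, map_zero]
    · rw [h1]
      refine (h.apply_eq_zero_or hk hL₁).imp_right ?_
      rintro ⟨L', hL', h4, h5, -⟩
      refine ⟨L', hL', h4, fun x => (h5 x).trans (h2 x), fun b hb => ?_⟩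
      have := h5 b
      have := h3 b hb
      omega

/-- Each word uses up one element of L at or below its j, so a nonzero result forces L to have at
least as many elements up to x as J. The base point b makes the induction close: the tail is used
with b = j. -/
theorem prod_descMonomial_apply_eq_zero_or (h : IsShiftAction n P e) {ks js : List ℕ}
    (hkj : List.Forall₂ (fun k j => k ≥ j) ks js) (hjs : js.Pairwise (· < ·))
    (hkn : ∀ k ∈ ks, k ≤ n) {b : ℕ} (hb : ∀ j ∈ js, b < j) {L : Finset ℕ}
    (hL : L ⊆ Icc 1 n) :
    (List.zipWith (descMonomial P) ks js).prod (e L) = 0 ∨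
      ∃ L' ⊆ Icc 1 n, (List.zipWith (descMonomial P) ks js).prod (e L) = e L' ∧
        (∀ x, countLE L' x ≤ countLE L x) ∧
        ∀ x, b ≤ x → countLE L' b + countLE js.toFinset x ≤ countLE L x := by
  induction hkj generalizing b with
  | nil =>
    refine Or.inr ⟨L, hL, by simp, fun x => le_rfl, fun x hx => ?_⟩
    simpa [countLE] using countLE_mono L hx
  | @cons k j ks js hkj hkjs ih =>
    rw [List.pairwise_cons] at hjs
    have hbj := hb j (by simp)
    rw [List.zipWith_cons_cons, List.prod_cons, Module.End.mul_apply]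
    rcases ih hjs.2 (fun a ha => hkn a (by simp [ha])) hjs.1 with h0 | ⟨L₁, hL₁, h1, h2, h3⟩
    · left
      rw [h0, map_zero]
    · rw [h1]
      refine (h.descMonomial_apply_eq_zero_or (by omega) hkj (hkn k (by simp)) hL₁).imp_right ?_
      rintro ⟨L', hL', h4, h5, h6⟩
      refine ⟨L', hL', h4, fun x => (h5 x).trans (h2 x), fun x hx => ?_⟩
      by_cases hxj : j ≤ x
      · have h7 := h3 x hxj
        have h8 := h6 b hbj
        have h9 : countLE (j :: js).toFinset x ≤ countLE js.toFinset x + 1 := by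
          rw [countLE, List.toFinset_cons, filter_insert, if_pos hxj]
          exact card_insert_le _ _
        omega
      · have h7 : countLE (j :: js).toFinset x = 0 := by
          rw [countLE, card_eq_zero, filter_eq_empty_iff]
          intro a ha
          rw [List.mem_toFinset, List.mem_cons] at ha
          rcases ha with rfl | ha
          · exact hxj
          · have := hjs.1 a ha
            omega
        have h8 := h5 b
        have h9 := h2 b
        have h10 := countLE_mono L hx
        omega

/-- If e_L survived, the counting function of L would be at least that of J; being also at most
that, it would give L = J. -/
theorem pairMonomial_apply_of_mem_above (h : IsShiftAction n P e) {K J : Finset ℕ}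
    (hK : K ⊆ Icc 1 n) (hJ : J ⊆ Icc 1 n) (hKJ : ProdGE K J) {v : V} (hv : v ∈ above R n e J) :
    pairMonomial P K J v = 0 := by
  have hzero : ∀ {L : Finset ℕ}, L ⊆ Icc 1 n → 0 ∉ L := fun hL h0 => by
    have := mem_Icc.1 (hL h0)
    omega
  have : above R n e J ≤ LinearMap.ker (pairMonomial P K J) := by
    refine Submodule.span_le.2 ?_
    rintro _ ⟨L, ⟨hL, hLJ, hne⟩, rfl⟩
    rcases h.prod_descMonomial_apply_eq_zero_or hKJ (J.sortedLT_sort).pairwise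
      (fun k hk => (mem_Icc.1 (hK ((mem_sort _).1 hk))).2) (b := 0)
      (fun j hj => (mem_Icc.1 (hJ ((mem_sort _).1 hj))).1) hL with h0 | ⟨L', hL', -, -, h1⟩
    · exact h0
    · refine absurd (eq_of_countLE_eq (hzero hL) (hzero hJ) fun x => (hLJ x).antisymm ?_) hne
      have := h1 x (Nat.zero_le x)
      rw [sort_toFinset] at this
      omega
  exact this hv

theorem fElt_mul_pairMonomial_mul_fElt_ne_zero [Nontrivial R] (h : IsShiftAction n P e)
    {K J : Finset ℕ} (hK : K ⊆ Icc 1 n) (hJ : J ⊆ Icc 1 n) (hKJ : ProdGE K J) (φ : V →ₗ[R] R)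
    (hφ : φ (e K) = 1) (hφ' : ∀ L ⊆ Icc 1 n, L ≠ K → φ (e L) = 0) :
    fElt P n K * pairMonomial P K J * fElt P n J ≠ 0 := by
  intro h0
  -- The monomial kills the correction terms of f_J e_J.
  have h1 : pairMonomial P K J (fElt P n J (e J)) = e K := by
    have := h.pairMonomial_apply_of_mem_above hK hJ hKJ (h.fElt_apply_sub_mem hJ)
    rwa [map_sub, h.pairMonomial_apply hK hJ hKJ, sub_eq_zero] at this
  have h2 : above R n e K ≤ LinearMap.ker φ := by
    refine Submodule.span_le.2 ?_
    rintro _ ⟨L, ⟨hL, -, hne⟩, rfl⟩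
    exact hφ' L hL hne
  have h3 : φ (fElt P n K (e K) - e K) = 0 := h2 (h.fElt_apply_sub_mem hK)
  have h4 := LinearMap.congr_fun h0 (e J)
  rw [Module.End.mul_apply, Module.End.mul_apply, h1, LinearMap.zero_apply] at h4
  rw [h4, zero_sub, map_neg, hφ] at h3
  simp at h3

end IsShiftAction

end Shift

/-! ### Compatibility of the elements with ring homomorphisms -/

section MapElements

variable {B C : Type*} [Ring B] [Ring C] (ρ : B →+* C) (p : ℕ → B)

theorem map_yElt (m k : ℕ) : ρ (yElt p m k) = yElt (fun i => ρ (p i)) m k := by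
  induction m generalizing k with
  | zero => cases k <;> simp [yElt]
  | succ m ih => cases k <;> simp [yElt, ih]

theorem map_zElt (m k : ℕ) : ρ (zElt p m k) = zElt (fun i => ρ (p i)) m k := by
  simp [zElt, map_yElt]

theorem map_gElt (m : ℕ) (J : Finset ℕ) : ρ (gElt p m J) = gElt (fun i => ρ (p i)) m J := by
  induction m generalizing J with
  | zero => simp [gElt]
  | succ m ih =>
    rw [gElt, gElt]
    split_ifs <;> simp [ih]

theorem map_fElt (m : ℕ) (J : Finset ℕ) : ρ (fElt p m J) = fElt (fun i => ρ (p i)) m J := by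
  rw [fElt, fElt]
  split_ifs <;> simp [map_gElt, map_zElt]

theorem map_descMonomial (k j : ℕ) :
    ρ (descMonomial p k j) = descMonomial (fun i => ρ (p i)) k j := by
  simp [descMonomial, map_list_prod, Function.comp_def]

theorem map_pairMonomial (K J : Finset ℕ) :
    ρ (pairMonomial p K J) = pairMonomial (fun i => ρ (p i)) K J := by
  rw [pairMonomial, pairMonomial, map_list_prod, List.map_zipWith]
  simp only [map_descMonomial]

end MapElements

/-! ### The action of endofunctors on sets of isomorphism classes -/

/-- Isomorphism classes of objects of a category. -/
def IsoClass (C : Type*) [Category* C] : Type _ := Quotient (isIsomorphicSetoid C)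

/-- The isomorphism class of an object. -/
def IsoClass.mk {C : Type*} [Category* C] (X : C) : IsoClass C :=
  Quotient.mk (isIsomorphicSetoid C) X

theorem IsoClass.mk_eq_mk {C : Type*} [Category* C] {X Y : C} :
    IsoClass.mk X = IsoClass.mk Y ↔ Nonempty (X ≅ Y) :=
  Quotient.eq

/-- The action of endofunctors on isomorphism classes of objects. -/
def EndoClass.onIsoClass (C : Type*) [Category* C] : EndoClass C →* Function.End (IsoClass C) where
  toFun F := Quotient.map₂ (fun (F : C ⥤ C) (X : C) => F.obj X)
    (by rintro F G ⟨α⟩ X Y ⟨β⟩; exact ⟨F.mapIso β ≪≫ α.app Y⟩) F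
  map_one' := by
    funext X
    induction X using Quotient.inductionOn
    rfl
  map_mul' F G := by
    funext X
    induction F using Quotient.inductionOn
    induction G using Quotient.inductionOn
    induction X using Quotient.inductionOn
    rfl

section ImageRep

variable (R : Type*) {α : Type*} [CommRing R]

open Classical in
/-- The linear map on the free module on the finite subsets of `α` that sends the basis vector of `X`
to that of `f(X)` if `f` is injective on `X`, and to zero otherwise. -/
def imageMap (f : α → α) : Module.End R (Finset α →₀ R) :=
  Finsupp.linearCombination R fun X : Finset α =>
    if Set.InjOn f X then Finsupp.single (X.image f) 1 else 0

variable {R}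

open Classical in
theorem imageMap_single_of_injOn {f : α → α} {X : Finset α} (h : Set.InjOn f X) :
    imageMap R f (Finsupp.single X 1) = Finsupp.single (X.image f) 1 := by
  simp [imageMap, h]

theorem imageMap_single_of_not_injOn {f : α → α} {X : Finset α} (h : ¬ Set.InjOn f X) :
    imageMap R f (Finsupp.single X 1) = 0 := by
  simp [imageMap, h]

theorem imageMap_id : imageMap R (id : α → α) = 1 := by
  classical
  refine Finsupp.lhom_ext' fun X => LinearMap.ext_ring ?_
  change imageMap R id (Finsupp.single X 1) = Finsupp.single X 1
  rw [imageMap_single_of_injOn (Set.injOn_id _), Finset.image_id]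

/-- The composite is injective on X exactly when g is injective on X and f on g(X), so the value
zero for noninjective maps is multiplicative. -/
theorem imageMap_comp (f g : α → α) : imageMap R (f ∘ g) = imageMap R f * imageMap R g := by
  classical
  refine Finsupp.lhom_ext' fun X => LinearMap.ext_ring ?_
  change imageMap R (f ∘ g) (Finsupp.single X 1) =
    imageMap R f (imageMap R g (Finsupp.single X 1))
  by_cases hg : Set.InjOn g X
  · rw [imageMap_single_of_injOn hg]
    have h : Set.InjOn f (X.image g : Finset α) ↔ Set.InjOn (f ∘ g) X := by
      rw [Finset.coe_image]
      exact ⟨fun h => h.comp hg (Set.mapsTo_image g X), fun h => h.image_of_comp⟩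
    by_cases hf : Set.InjOn f (X.image g : Finset α)
    · rw [imageMap_single_of_injOn hf, imageMap_single_of_injOn (h.1 hf), Finset.image_image]
    · rw [imageMap_single_of_not_injOn hf, imageMap_single_of_not_injOn (mt h.2 hf)]
  · rw [imageMap_single_of_not_injOn hg, map_zero, imageMap_single_of_not_injOn]
    exact fun h => hg h.of_comp

variable (R α) in
/-- The representation of the maps from `α` to itself on the free module on the finite subsets
of `α`. -/
def imageRep : Function.End α →* Module.End R (Finset α →₀ R) where
  toFun f := imageMap R f
  map_one' := imageMap_id
  map_mul' f g := imageMap_comp f g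

end ImageRep

/-! ### The uniserial modules with top at the vertex `1` -/

/-- Together with `range_le_genPart` this identifies the generated part as the trace of U, the sum
of the images of all maps U → M. -/
theorem genPart_le {A : Type u} [Ring A] {U M : Type u} [AddCommGroup U] [Module A U]
    [AddCommGroup M] [Module A M] {W : Submodule A M} (h : ∀ (φ : U →ₗ[A] M) (x : U), φ x ∈ W) :
    genPart A U M ≤ W := by
  refine sSup_le ?_
  rintro X ⟨d, f, hf⟩ x hx
  obtain ⟨v, hv⟩ := hf ⟨x, hx⟩
  have : x = ∑ i, X.subtype (f (Pi.single i (v i))) := by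
    rw [← map_sum, ← map_sum, Finset.univ_sum_single, hv]
    rfl
  rw [this]
  exact sum_mem fun i _ => h (X.subtype ∘ₗ f ∘ₗ LinearMap.single A (fun _ => U) i) (v i)

theorem range_le_genPart {A : Type u} [Ring A] {U M : Type u} [AddCommGroup U] [Module A U]
    [AddCommGroup M] [Module A M] (φ : U →ₗ[A] M) : LinearMap.range φ ≤ genPart A U M :=
  le_sSup ⟨1, φ.rangeRestrict ∘ₗ LinearMap.proj 0, φ.surjective_rangeRestrict.comp
    (LinearMap.proj_surjective (φ := fun _ : Fin 1 => U) 0)⟩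

/-- The representation of the quiver `Q` with the space `k` at every vertex and the identity at every
arrow. -/
abbrev ConstRep (k : Type u) (Q : Type) : Type u := Q → k

namespace ConstRep

variable (k : Type u) (Q : Type) [Field k] [Quiver.{0} Q]

open Classical in
/-- The action of the path algebra on the constant representation, as a linear map. -/
def actMap : PathAlgebra k Q →ₗ[k] Module.End k (ConstRep k Q) :=
  Finsupp.linearCombination k fun p : QPath Q =>
    (LinearMap.single k (fun _ : Q => k) p.tgt ∘ₗ LinearMap.proj p.src :
      (Q → k) →ₗ[k] (Q → k))

open Classical in
theorem actMap_ofPath (p : QPath Q) (v : ConstRep k Q) :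
    actMap k Q (PathAlgebra.ofPath p) v = (Pi.single p.tgt (v p.src) : Q → k) := by
  unfold actMap PathAlgebra.ofPath
  erw [Finsupp.linearCombination_single, one_smul]
  rfl

variable [Fintype Q]

/-- The action of the path algebra on the constant representation, as a ring homomorphism. -/
def actHom : PathAlgebra k Q →+* Module.End k (ConstRep k Q) where
  toFun := actMap k Q
  map_add' := map_add (actMap k Q)
  map_zero' := map_zero (actMap k Q)
  map_one' := by
    classical
    refine LinearMap.ext fun v => ?_
    change actMap k Q 1 v = v
    rw [PathAlgebra.one_def, map_sum, LinearMap.sum_apply]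
    simp only [actMap_ofPath]
    exact Finset.univ_sum_single (v : Q → k)
  map_mul' a b := by
    classical
    have : PathAlgebra.mulMap.compr₂ (actMap k Q) =
        (LinearMap.mul k (Module.End k (ConstRep k Q))).compl₁₂ (actMap k Q) (actMap k Q) := by
      refine PathAlgebra.hom_ext fun p => PathAlgebra.hom_ext fun q => ?_
      change actMap k Q (PathAlgebra.ofPath p * PathAlgebra.ofPath q) =
        actMap k Q (PathAlgebra.ofPath p) * actMap k Q (PathAlgebra.ofPath q)
      refine LinearMap.ext fun v => ?_
      rw [Module.End.mul_apply, actMap_ofPath k Q q, actMap_ofPath]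
      obtain ⟨p1, p2, p⟩ := p
      obtain ⟨q1, q2, q⟩ := q
      by_cases h : q2 = p1
      · subst h
        rw [PathAlgebra.ofPath_mul_of_eq, actMap_ofPath]
        simp
      · rw [PathAlgebra.ofPath_mul_of_ne h, map_zero]
        simp [Pi.single_eq_of_ne (Ne.symm h)]
    exact congrArg (fun F => F a b) this

instance : Module (PathAlgebra k Q) (ConstRep k Q) :=
  Module.compHom (ConstRep k Q) (actHom k Q)


theorem smul_def (a : PathAlgebra k Q) (v : ConstRep k Q) : a • v = actMap k Q a v := rfl

open Classical in
theorem ofPath_smul (p : QPath Q) (v : ConstRep k Q) :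
    (PathAlgebra.ofPath p : PathAlgebra k Q) • v = (Pi.single p.tgt (v p.src) : Q → k) :=
  actMap_ofPath k Q p v

instance : IsScalarTower k (PathAlgebra k Q) (ConstRep k Q) where
  smul_assoc c a v := by
    rw [smul_def, smul_def, map_smul, LinearMap.smul_apply]

instance : Module.Finite (PathAlgebra k Q) (ConstRep k Q) :=
  Module.Finite.of_restrictScalars_finite k _ _

end ConstRep

variable (R : Type u) [Field R] (n : ℕ)

/-- The subrepresentation of the constant representation of `1 → ⋯ → n` that is supported on the
vertices greater than `b`. -/
def tailRep (b : ℕ) : Submodule (PathAlgebra R (LinQuiver n)) (ConstRep R (LinQuiver n)) where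
  carrier := {v | ∀ i : LinQuiver n, i.1 ≤ b → v i = 0}
  zero_mem' _ _ := rfl
  add_mem' {v w} hv hw i hi := by rw [Pi.add_apply, hv i hi, hw i hi, add_zero]
  smul_mem' a v hv i hi := by
    classical
    have : LinearMap.proj i ∘ₗ (ConstRep.actMap R (LinQuiver n)).flip v = 0 := by
      refine PathAlgebra.hom_ext fun p => ?_
      change ConstRep.actMap R (LinQuiver n) (PathAlgebra.ofPath p) v i = 0
      rw [ConstRep.actMap_ofPath]
      by_cases h : i = p.tgt
      · subst h
        -- Paths never lower the vertex, so the source is also at most b.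
        have := LinQuiver.path_length p.path
        rw [Pi.single_eq_same, hv _ (by omega)]
      · rw [Pi.single_eq_of_ne h]
    exact LinearMap.congr_fun this a

variable {R n}

theorem tailRep_anti {b c : ℕ} (h : b ≤ c) : tailRep R n c ≤ tailRep R n b :=
  fun _ hv i hi => hv i (hi.trans h)

variable (R n) in
/-- The uniserial module with composition factors at the vertices `1, …, b`, from the top down. -/
def uniserial (b : ℕ) : FGModuleCat.{u} (PathAlgebra R (LinQuiver n)) :=
  FGModuleCat.of _ (ConstRep R (LinQuiver n) ⧸ tailRep R n b)

theorem VertexModule.ofPath_smul {t : LinQuiver n} (p : QPath (LinQuiver n))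
    (hp : p ≠ QPath.nil t) (x : VertexModule R t) :
    (PathAlgebra.ofPath p : PathAlgebra R (LinQuiver n)) • x = 0 := by
  classical
  refine (VertexModule.smul_def R t _ x).trans ?_
  rw [PathAlgebra.vertexHom_apply, PathAlgebra.coeff_ofPath, if_neg hp]
  exact zero_mul (M₀ := R) x

theorem VertexModule.nil_smul {t : LinQuiver n} (x : VertexModule R t) :
    (PathAlgebra.ofPath (QPath.nil t) : PathAlgebra R (LinQuiver n)) • x = x := by
  classical
  refine (VertexModule.smul_def R t _ x).trans ?_
  rw [PathAlgebra.vertexHom_apply, PathAlgebra.coeff_ofPath, if_pos rfl]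
  exact one_mul (M := R) x

/-- The image of a map from the simple module at `t` to the uniserial module of length `b` vanishes
if `t ≠ b`, and lies in the socle if `t = b`. -/
theorem hom_vertexModule_mem {t : LinQuiver n} {b : ℕ} (hb : b ≤ n)
    (φ : VertexModule R t →ₗ[PathAlgebra R (LinQuiver n)]
      (ConstRep R (LinQuiver n) ⧸ tailRep R n b)) (x : VertexModule R t) :
    φ x ∈ (tailRep R n (if b = t.1 then b - 1 else b)).map (tailRep R n b).mkQ := by
  classical
  obtain ⟨v, hv⟩ := Submodule.mkQ_surjective _ (φ x)
  -- The idempotent at t fixes x, so its image has a representative concentrated at t.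
  have h1 : (tailRep R n b).mkQ (Pi.single t (v t)) = φ x := by
    conv_rhs => rw [← VertexModule.nil_smul x, map_smul, ← hv, ← map_smul, ConstRep.ofPath_smul]
    rfl
  refine ⟨Pi.single t (v t), ?_, h1⟩
  intro i hi
  by_cases h : i = t
  · subst h
    rw [Pi.single_eq_same]
    have ht := Finset.mem_Icc.1 i.2
    split_ifs at hi with h2
    · omega
    -- Here t < b: the arrow t → t + 1 kills x but acts injectively from t to t + 1 ≤ b in the
    -- uniserial module, which forces v t = 0.
    · let j : LinQuiver n := ⟨i.1 + 1, Finset.mem_Icc.2 ⟨by omega, by omega⟩⟩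
      let a : i ⟶ j := ⟨rfl⟩
      have h3 : (tailRep R n b).mkQ (Pi.single j (v i)) = 0 := by
        have h4 := VertexModule.ofPath_smul (R := R) (t := i) ⟨i, j, a.toPath⟩
          (fun h5 => by simpa [QPath.nil, j] using congrArg (fun q => q.tgt.1) h5) x
        have h6 := congrArg φ h4
        rw [map_smul, ← hv, ← map_smul, ConstRep.ofPath_smul, map_zero] at h6
        exact h6
      rw [Submodule.mkQ_apply, Submodule.Quotient.mk_eq_zero] at h3
      have h7 := h3 j (show i.1 + 1 ≤ b by omega)
      rwa [Pi.single_eq_same] at h7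
  · rw [Pi.single_eq_of_ne h]

open Classical in
-- A path from t other than the trivial one ends beyond t and is invisible at vertices up to t. This
-- gives the linearity of `socleHom`.
theorem smul_single_apply (t : LinQuiver n) (a : PathAlgebra R (LinQuiver n)) (x : R)
    {i : LinQuiver n} (hi : i.1 ≤ t.1) :
    (a • (Pi.single t x : ConstRep R (LinQuiver n))) i =
      (Pi.single t (PathAlgebra.vertexHom R t a * x) : ConstRep R (LinQuiver n)) i := by
  have : LinearMap.proj i ∘ₗ (ConstRep.actMap R (LinQuiver n)).flip (Pi.single t x) =
      LinearMap.proj i ∘ₗ LinearMap.single R (fun _ => R) t ∘ₗ LinearMap.toSpanSingleton R R x ∘ₗ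
        PathAlgebra.coeff (QPath.nil t) := by
    refine PathAlgebra.hom_ext fun p => ?_
    change ConstRep.actMap R (LinQuiver n) (PathAlgebra.ofPath p) (Pi.single t x) i =
      (Pi.single t (PathAlgebra.coeff (QPath.nil t) (PathAlgebra.ofPath p : PathAlgebra R _) * x) :
        ConstRep R (LinQuiver n)) i
    rw [ConstRep.actMap_ofPath, PathAlgebra.coeff_ofPath]
    by_cases hp : p = QPath.nil t
    · subst hp
      simp [QPath.nil]
    · rw [if_neg hp, zero_mul, Pi.single_zero, Pi.zero_apply]
      obtain ⟨p1, p2, p⟩ := p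
      by_cases h1 : p1 = t
      · subst h1
        refine Pi.single_eq_of_ne (fun h2 => hp ?_) _
        subst h2
        have := LinQuiver.path_length p
        obtain rfl : p1 = i := Subtype.ext (by omega)
        rw [LinQuiver.path_subsingleton p Quiver.Path.nil, QPath.nil]
      · rw [Pi.single_eq_of_ne h1, Pi.single_zero, Pi.zero_apply]
  exact LinearMap.congr_fun this a

open Classical in
variable (R) in
/-- The inclusion of the simple module at `t` as the socle of the uniserial module of length `t`. -/
def socleHom (t : LinQuiver n) : VertexModule R t →ₗ[PathAlgebra R (LinQuiver n)]
    (ConstRep R (LinQuiver n) ⧸ tailRep R n t.1) where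
  toFun x := (tailRep R n t.1).mkQ (LinearMap.single R (fun _ => R) t x)
  map_add' x y :=
    (congrArg (tailRep R n t.1).mkQ ((LinearMap.single R (fun _ => R) t).map_add x y)).trans
      (map_add _ _ _)
  map_smul' a x := by
    rw [RingHom.id_apply, ← map_smul, ← sub_eq_zero, ← map_sub, Submodule.mkQ_apply,
      Submodule.Quotient.mk_eq_zero]
    intro i hi
    rw [Pi.sub_apply, sub_eq_zero]
    exact (smul_single_apply t a x hi).symm

theorem genPart_uniserial (t : LinQuiver n) {b : ℕ} (hb : b ≤ n) :
    genPart (PathAlgebra R (LinQuiver n)) (VertexModule R t)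
        (ConstRep R (LinQuiver n) ⧸ tailRep R n b) =
      (tailRep R n (if b = t.1 then b - 1 else b)).map (tailRep R n b).mkQ := by
  classical
  refine le_antisymm (genPart_le (hom_vertexModule_mem hb)) ?_
  split_ifs with h
  · subst h
    refine le_trans ?_ (range_le_genPart (socleHom R t))
    rintro _ ⟨v, hv, rfl⟩
    refine ⟨v t, ?_⟩
    change (tailRep R n t.1).mkQ (Pi.single t (v t) : ConstRep R (LinQuiver n)) = _
    rw [← sub_eq_zero, ← map_sub, Submodule.mkQ_apply, Submodule.Quotient.mk_eq_zero]
    intro i hi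
    rw [Pi.sub_apply]
    by_cases h : i = t
    · subst h
      rw [Pi.single_eq_same, sub_self]
    · have : i.1 ≠ t.1 := fun h' => h (Subtype.ext h')
      rw [Pi.single_eq_of_ne h, hv i (by omega), sub_self]
  · rw [Submodule.mkQ_map_self]
    exact bot_le

/-- The third isomorphism theorem: for b = t the socle is factored out, otherwise nothing is. -/
theorem projFunctor_uniserial (t : LinQuiver n) {b : ℕ} (hb : b ≤ n) :
    Nonempty ((projFunctor (FGModuleCat.of _ (VertexModule R t))).obj (uniserial R n b) ≅
      uniserial R n (if b = t.1 then b - 1 else b)) := by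
  have h : tailRep R n b ≤ tailRep R n (if b = t.1 then b - 1 else b) :=
    tailRep_anti (by split_ifs <;> omega)
  let e : ((ConstRep R (LinQuiver n) ⧸ tailRep R n b) ⧸
      genPart (PathAlgebra R (LinQuiver n)) (VertexModule R t)
        (ConstRep R (LinQuiver n) ⧸ tailRep R n b)) ≃ₗ[PathAlgebra R (LinQuiver n)]
      (ConstRep R (LinQuiver n) ⧸ tailRep R n (if b = t.1 then b - 1 else b)) :=
    (Submodule.quotEquivOfEq _ _ (genPart_uniserial t hb)).trans
      (Submodule.quotientQuotientEquivQuotient _ _ h)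
  exact ⟨e.toFGModuleCatIso⟩

/-- If b < c, the idempotent at c annihilates the module of length b but not the one of length c. -/
theorem uniserial_iso_le {b c : ℕ} (hc : c ≤ n) (e : uniserial R n b ≅ uniserial R n c) :
    c ≤ b := by
  classical
  by_contra! h
  let f : (ConstRep R (LinQuiver n) ⧸ tailRep R n b) ≃ₗ[PathAlgebra R (LinQuiver n)]
    (ConstRep R (LinQuiver n) ⧸ tailRep R n c) := FGModuleCat.isoToLinearEquiv e
  let t : LinQuiver n := ⟨c, Finset.mem_Icc.2 ⟨by omega, hc⟩⟩
  obtain ⟨v, hv⟩ := Submodule.mkQ_surjective _ (f.symm ((tailRep R n c).mkQ (Pi.single t 1)))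
  have h1 : (PathAlgebra.ofPath (QPath.nil t) : PathAlgebra R (LinQuiver n)) •
      (tailRep R n b).mkQ v = 0 := by
    rw [← map_smul, ConstRep.ofPath_smul, Submodule.mkQ_apply, Submodule.Quotient.mk_eq_zero]
    intro i hi
    refine Pi.single_eq_of_ne (fun h2 => ?_) _
    have : i.1 = c := congrArg Subtype.val h2
    omega
  rw [hv, ← map_smul, ← map_smul, ConstRep.ofPath_smul, LinearEquiv.map_eq_zero_iff,
    Submodule.mkQ_apply, Submodule.Quotient.mk_eq_zero] at h1
  have h2 := h1 t le_rfl
  simp [QPath.nil] at h2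

/-! ### The resulting shift action -/

variable (R n) in
/-- The isomorphism class of the uniserial module of length `b`. -/
def uniserialClass (b : ℕ) : IsoClass (FGModuleCat.{u} (PathAlgebra R (LinQuiver n))) :=
  IsoClass.mk (uniserial R n b)

theorem uniserialClass_injOn : Set.InjOn (uniserialClass R n) (Finset.range (n + 1)) := by
  intro b hb c hc h
  obtain ⟨e⟩ := IsoClass.mk_eq_mk.1 h
  rw [Finset.coe_range, Set.mem_Iio] at hb hc
  exact le_antisymm (uniserial_iso_le (by omega) e.symm) (uniserial_iso_le (by omega) e)

theorem projClass_uniserialClass (t : LinQuiver n) {b : ℕ} (hb : b ≤ n) :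
    EndoClass.onIsoClass _ (projClass R t).1 (uniserialClass R n b) =
      uniserialClass R n (if b = t.1 then b - 1 else b) :=
  IsoClass.mk_eq_mk.2 (projFunctor_uniserial t hb)

variable (R n) in
/-- The representation of `A_n` on the free module on the finite sets of isomorphism classes. -/
def isoClassRep : AlgA R n →ₐ[R]
    Module.End R (Finset (IsoClass (FGModuleCat.{u} (PathAlgebra R (LinQuiver n)))) →₀ R) :=
  MonoidAlgebra.lift R _ _ ((imageRep R _).comp
    ((EndoClass.onIsoClass (FGModuleCat.{u} (PathAlgebra R (LinQuiver n)))).comp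
      (projMonoid (PathAlgebra R (LinQuiver n))).subtype))

theorem isoClassRep_gen {m : ℕ} (hm : m + 1 ∈ Finset.Icc 1 n) :
    isoClassRep R n (gen R n (m + 1)) = imageMap R
      (EndoClass.onIsoClass _ (projClass R (⟨m + 1, hm⟩ : LinQuiver n)).1) := by
  rw [gen, dif_pos hm, isoClassRep, MonoidAlgebra.of_apply, MonoidAlgebra.lift_single, one_smul]
  rfl

open Classical in
variable (R n) in
/-- The set of the classes of the uniserial modules whose length lies in `{0, …, n}` but not
in `J`. -/
def complSet (J : Finset ℕ) : Finset (IsoClass (FGModuleCat.{u} (PathAlgebra R (LinQuiver n)))) :=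
  (Finset.range (n + 1) \ J).image (uniserialClass R n)

theorem complSet_injOn {J L : Finset ℕ} (hJ : J ⊆ Finset.Icc 1 n) (hL : L ⊆ Finset.Icc 1 n)
    (h : complSet R n J = complSet R n L) : J = L := by
  classical
  have hsub : ∀ {J : Finset ℕ}, J ⊆ Finset.Icc 1 n → J ⊆ Finset.range (n + 1) := fun hJ a ha => by
    have := Finset.mem_Icc.1 (hJ ha)
    exact Finset.mem_range.2 (by omega)
  have h1 : Finset.range (n + 1) \ J = Finset.range (n + 1) \ L := by
    rw [complSet, complSet, ← Finset.coe_inj, Finset.coe_image, Finset.coe_image,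
      uniserialClass_injOn.image_eq_image_iff (Finset.coe_subset.2 Finset.sdiff_subset)
        (Finset.coe_subset.2 Finset.sdiff_subset)] at h
    exact Finset.coe_inj.1 h
  rw [← Finset.sdiff_sdiff_eq_self (hsub hJ), h1, Finset.sdiff_sdiff_eq_self (hsub hL)]

variable (R n) in
/-- The basis vector of the set `complSet R n J`. -/
def complVec (J : Finset ℕ) :
    Finset (IsoClass (FGModuleCat.{u} (PathAlgebra R (LinQuiver n)))) →₀ R :=
  Finsupp.single (complSet R n J) 1

/-- The map of `ℕ` to itself that sends `m + 1` to `m` and fixes all other elements. -/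
def lower (m b : ℕ) : ℕ := if b = m + 1 then b - 1 else b

/-- Since distinct lengths give distinct classes, the action on sets of classes reduces to that of
`lower m` on sets of lengths. -/
theorem isoClassRep_gen_complVec {m : ℕ} (hm : m + 1 ≤ n) {J J' : Finset ℕ}
    (hinj : Set.InjOn (lower m) (Finset.range (n + 1) \ J : Finset ℕ))
    (him : (Finset.range (n + 1) \ J).image (lower m) = Finset.range (n + 1) \ J') :
    isoClassRep R n (gen R n (m + 1)) (complVec R n J) = complVec R n J' := by
  classical
  have hm' : m + 1 ∈ Finset.Icc 1 n := Finset.mem_Icc.2 ⟨by omega, hm⟩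
  rw [isoClassRep_gen hm', complVec]
  set F := EndoClass.onIsoClass _ (projClass R (⟨m + 1, hm'⟩ : LinQuiver n)).1
  have hF : ∀ b ∈ Finset.range (n + 1) \ J,
      F (uniserialClass R n b) = uniserialClass R n (lower m b) := fun b hb => by
    have := Finset.mem_range.1 (Finset.mem_sdiff.1 hb).1
    exact projClass_uniserialClass _ (by omega)
  have hlow : ∀ b ∈ Finset.range (n + 1) \ J, lower m b ∈ Finset.range (n + 1) := fun b hb =>
    (Finset.mem_sdiff.1 (him ▸ Finset.mem_image_of_mem (lower m) hb)).1
  have hFinj : Set.InjOn F (complSet R n J) := by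
    intro x hx y hy hxy
    rw [complSet, Finset.mem_coe, Finset.mem_image] at hx hy
    obtain ⟨b, hb, rfl⟩ := hx
    obtain ⟨c, hc, rfl⟩ := hy
    rw [hF b hb, hF c hc] at hxy
    rw [hinj hb hc (uniserialClass_injOn (hlow b hb) (hlow c hc) hxy)]
  rw [imageMap_single_of_injOn hFinj, complVec, complSet, complSet, ← him, Finset.image_image]
  congr 1
  exact Finset.image_image.trans (Finset.image_congr hF)

/-- The uniserial modules of lengths m and m + 1 both belong to the set and both go to the class of
length m, so injectivity fails. -/
theorem isoClassRep_gen_complVec_eq_zero {m : ℕ} (hm : m + 1 ≤ n) {J : Finset ℕ}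
    (h0 : m ∉ J) (h1 : m + 1 ∉ J) :
    isoClassRep R n (gen R n (m + 1)) (complVec R n J) = 0 := by
  classical
  have hm' : m + 1 ∈ Finset.Icc 1 n := Finset.mem_Icc.2 ⟨by omega, hm⟩
  rw [isoClassRep_gen hm', complVec]
  refine imageMap_single_of_not_injOn fun h => ?_
  have hmem : ∀ b, b ≤ n → b ∉ J → uniserialClass R n b ∈ (complSet R n J : Set _) :=
    fun b hb hbJ => Finset.mem_coe.2 (Finset.mem_image_of_mem _
      (Finset.mem_sdiff.2 ⟨Finset.mem_range.2 (by omega), hbJ⟩))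
  have h2 := h (hmem (m + 1) hm h1) (hmem m (by omega) h0)
    ((projClass_uniserialClass _ hm).trans
      (Eq.trans (by simp) (projClass_uniserialClass _ (by omega)).symm))
  have h3 := uniserialClass_injOn (Finset.mem_coe.2 (Finset.mem_range.2 (by omega)))
    (Finset.mem_coe.2 (Finset.mem_range.2 (by omega))) h2
  omega

/-- Lowering the length m + 1 to m moves the hole at m to m + 1. As 0 is never a hole, p_1 kills e_J
unless 1 ∈ J. -/
theorem isShiftAction_complVec :
    IsShiftAction n (fun i => isoClassRep R n (gen R n i)) (complVec R n) where
  of_mem {m J} hm hJ hmJ := by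
    have h : ∀ b ∈ Finset.range (n + 1) \ J, lower m b = b := fun b hb =>
      if_neg fun h : b = m + 1 => (Finset.mem_sdiff.1 hb).2 (h ▸ hmJ)
    refine isoClassRep_gen_complVec hm (fun b hb c hc h1 => ?_) ?_
    · rwa [h b hb, h c hc] at h1
    · rw [Finset.image_congr h]
      exact Finset.image_id
  of_pred_mem {m J} hm hJ hmJ hmJ' := by
    refine isoClassRep_gen_complVec hm (fun b hb c hc h1 => ?_) ?_
    · have hb' : b ≠ m := fun h => (Finset.mem_sdiff.1 hb).2 (h ▸ hmJ')
      have hc' : c ≠ m := fun h => (Finset.mem_sdiff.1 hc).2 (h ▸ hmJ')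
      unfold lower at h1
      split_ifs at h1 <;> omega
    · ext a
      simp only [Finset.mem_image, Finset.mem_sdiff, Finset.mem_range, shiftUp, Finset.mem_insert,
        Finset.mem_erase]
      constructor
      · rintro ⟨b, ⟨hb, hbJ⟩, rfl⟩
        unfold lower
        split_ifs with h
        · subst h
          exact ⟨by omega, by simp⟩
        · exact ⟨hb, by simp [h, hbJ]⟩
      · rintro ⟨ha, haJ⟩
        by_cases h : a = m
        · subst h
          exact ⟨a + 1, ⟨by omega, hmJ⟩, by simp [lower]⟩
        · exact ⟨a, ⟨ha, fun h' => haJ (Or.inr ⟨h, h'⟩)⟩, if_neg fun h' => haJ (Or.inl h')⟩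
  of_notMem hm _ h1 h0 := isoClassRep_gen_complVec_eq_zero hm h0 h1

theorem fElt_gen_mul_pairMonomial_mul_fElt_ne_zero {K J : Finset ℕ}
    (hK : K ⊆ Finset.Icc 1 n) (hJ : J ⊆ Finset.Icc 1 n) (hKJ : ProdGE K J) :
    fElt (gen R n) n K * pairMonomial (gen R n) K J * fElt (gen R n) n J ≠ 0 := by
  intro h
  let ρ := (isoClassRep R n).toRingHom
  have hf : ∀ L, ρ (fElt (gen R n) n L) = fElt (fun i => ρ (gen R n i)) n L :=
    map_fElt (C := Module.End R (_ →₀ R)) ρ (gen R n) n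
  have hp : ρ (pairMonomial (gen R n) K J) = pairMonomial (fun i => ρ (gen R n i)) K J :=
    map_pairMonomial (C := Module.End R (_ →₀ R)) ρ (gen R n) K J
  have h1 := congrArg ρ h
  rw [map_mul, map_mul, map_zero, hf, hf, hp] at h1
  refine isShiftAction_complVec.fElt_mul_pairMonomial_mul_fElt_ne_zero hK hJ hKJ
    (Finsupp.lapply (complSet R n K)) ?_ ?_ h1
  · exact Finsupp.single_eq_same
  · intro L hL hLK
    exact Finsupp.single_eq_of_ne fun h2 => hLK (complSet_injOn hK hL h2).symm

end ProjectionFunctors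

end

theorem mainTheorem9 (R : Type u) [Field R] (n : ℕ) (K J : Finset ℕ)
    (hK : K ⊆ Finset.Icc 1 n) (hJ : J ⊆ Finset.Icc 1 n)
    (hKJ : ProjectionFunctors.ProdGE K J) :
    ProjectionFunctors.fElt (ProjectionFunctors.gen R n) n K *
        ProjectionFunctors.pairMonomial (ProjectionFunctors.gen R n) K J *
        ProjectionFunctors.fElt (ProjectionFunctors.gen R n) n J ≠ 0 :=
  ProjectionFunctors.fElt_gen_mul_pairMonomial_mul_fElt_ne_zero hK hJ hKJ
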